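/- For a sequence $\alpha=\{\alpha_n\}_{n=0}^\infty$ in the closed unit disk $\overline{\mathbb D}\subset\mathbb C$ put $\rho_n=(1-|\alpha_n|^2)^{1/2}$ and $\alpha_{-1}=-1$. The GGT matrix $\mathcal G(\alpha)$ is the infinite matrix with entries ($k,\ell\ge 0$) $$\mathcal G_{k\ell}(\alpha)=\begin{cases}-\overline{\alpha_\ell}\,\alpha_{k-1}\prod_{m=k}^{\ell-1}\rho_m, & 0\le k\le \ell,\\ \rho_\ell, & k=\ell+1,\\ 0, & k\ge \ell+2.\end{cases}$$ (If all $|\alpha_n|<1$, this is $\langle\varphi_k,z\varphi_\ell\rangle$, where the $\varphi_n$ are the orthonormal polynomials on the unit circle with Verblunsky coefficients $\alpha_n$.) **Theorem 10.4.** Let $\alpha=\{\alpha_n\}_{n=0}^\infty$ and $\beta=\{\beta_n\}_{n=0}^\infty$ be two sequences in $\overline{\mathbb D}$, and let $\rho_n=(1-|\alpha_n|^2)^{1/2}$ and $\sigma_n=(1-|\beta_n|^2)^{1/2}$. Then $\mathcal G(\alpha)$ and $\mathcal G(\beta)$ are the matrices, in the standard basis, of bounded operators on $\ell^2(\{0,1,2,\dots\})$,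 and $$\|\mathcal G(\alpha)-\mathcal G(\beta)\|_1\le 2\sum_{n=0}^\infty\bigl(|\alpha_n-\beta_n|+|\sigma_n-\rho_n|\bigr),$$ where $\|A\|_1=\operatorname{Tr}|A|=\sum_n\langle\delta_n,(A^*A)^{1/2}\delta_n\rangle\in[0,\infty]$ is the trace norm, and both sides may be $+\infty$. In particular, if the right-hand side is finite, the difference is trace class. -/

import Mathlib

open scoped ENNReal lp

/-- `ρ = (1 - |α|²)^{1/2}`, the complementary modulus of a point `α` of the closed unit disk. -/
noncomputable def rhoOf (a : ℂ) : ℝ := Real.sqrt (1 - ‖a‖ ^ 2)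

/-- The coefficient `α_{k-1}`, with the boundary convention `α_{-1} = -1`. -/
noncomputable def prevCoeff (α : ℕ → ℂ) : ℕ → ℂ
  | 0 => -1
  | k + 1 => α k

/-- Entry `(k, l)` of the GGT matrix of the sequence `α`:
`- conj α_l * α_{k-1} * ρ_k ⋯ ρ_{l-1}` on and above the diagonal, `ρ_l` on the first
subdiagonal, and `0` below it. For `α` with values in the open disk this is the matrix
`⟨φ_k, z φ_l⟩` in the orthonormal polynomials of the measure with Verblunsky
coefficients `α`. -/
noncomputable def ggt (α : ℕ → ℂ) (k l : ℕ) : ℂ :=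
  if k ≤ l then
    -(starRingEnd ℂ (α l)) * prevCoeff α k * ∏ m ∈ Finset.Ico k l, (rhoOf (α m) : ℂ)
  else if k = l + 1 then (rhoOf (α l) : ℂ)
  else 0

/-- The complex Hilbert space of square-summable sequences indexed by `0, 1, 2, …`. -/
abbrev SeqSpace : Type := ℓ²(ℕ, ℂ)

/-- The standard basis `δ_0, δ_1, …` of `SeqSpace`. -/
noncomputable def stdBasis : HilbertBasis ℕ ℂ SeqSpace :=
  HilbertBasis.ofRepr (LinearIsometryEquiv.refl ℂ SeqSpace)

theorem stdBasis_apply (n : ℕ) : stdBasis n = lp.single 2 n (1 : ℂ) :=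
  (HilbertBasis.repr_symm_single stdBasis n).symm

/-- The bounded operator `A` is the one whose matrix in the standard basis is `M`, that is,
`M k l = ⟨δ_k, A δ_l⟩` with the inner product linear in its second argument
(a bounded operator is determined by its matrix, so there is at most one such `A`). -/
def HasMatrix (A : SeqSpace →L[ℂ] SeqSpace) (M : ℕ → ℕ → ℂ) : Prop :=
  ∀ k l : ℕ, inner ℂ (stdBasis k) (A (stdBasis l)) = M k l

/-- The absolute value `|A| = (A* A)^{1/2}` of a bounded operator on a complex Hilbert space. -/
noncomputable def absOp {H : Type*} [NormedAddCommGroup H] [InnerProductSpace ℂ H]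
    [CompleteSpace H] (A : H →L[ℂ] H) : H →L[ℂ] H :=
  CFC.abs A

/-- The trace norm `‖A‖₁ = Tr |A| = ∑ ⟨b_i, |A| b_i⟩ ∈ [0, ∞]`, computed in an orthonormal
basis `b` (its value does not depend on `b`). It is finite exactly when `A` is trace class.
Each summand is a nonnegative real number because `|A|` is a positive operator. -/
noncomputable def traceNorm {ι H : Type*} [NormedAddCommGroup H] [InnerProductSpace ℂ H]
    [CompleteSpace H] (b : HilbertBasis ι ℂ H) (A : H →L[ℂ] H) : ℝ≥0∞ :=
  ∑' i : ι, ENNReal.ofReal (RCLike.re (inner ℂ (b i) (absOp A (b i))))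

section Polar

variable {ι H : Type*} [NormedAddCommGroup H] [InnerProductSpace ℂ H] [CompleteSpace H]

/-! Formally `G(α) = Θ_0 Θ_1 ⋯`, where `Θ_n` rotates `δ_n, δ_{n+1}` by the unitary block with
columns `(conj α_n, ρ_n)` and `(ρ_n, -α_n)`. Replacing the factors one at a time writes `G(α) -
G(β)` as the sum of `Θ_0(α)⋯Θ_{n-1}(α) (Θ_n(α) - Θ_n(β)) Θ_{n+1}(β)⋯`. Each summand has two rank-one
pieces, one per column of the block: a vector of norm at most `|α_n - β_n| + |σ_n - ρ_n|` times a
row of norm at most 1, whence the factor 2. No infinite product is needed: each column meets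
finitely many pieces (`ggtCol_sub`), which is the input of `traceNorm_le_tsum_of_expansion`. -/

theorem norm_absOp_apply (A : H →L[ℂ] H) (x : H) : ‖absOp A x‖ = ‖A x‖ := by
  have hsa : IsSelfAdjoint (absOp A) := IsSelfAdjoint.of_nonneg (CFC.abs_nonneg A)
  have h : (inner ℂ (absOp A x) (absOp A x) : ℂ) = inner ℂ (A x) (A x) := by
    have h1 : inner ℂ (absOp A x) (absOp A x) = inner ℂ x ((absOp A * absOp A) x) := by
      conv_lhs => rw [← ContinuousLinearMap.adjoint_inner_right,
        ContinuousLinearMap.isSelfAdjoint_iff'.mp hsa]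
      rfl
    rw [h1, absOp, CFC.abs_mul_abs, ContinuousLinearMap.star_eq_adjoint,
      mul_apply_eq_comp, ContinuousLinearMap.adjoint_inner_right]
  rw [inner_self_eq_norm_sq_to_K, inner_self_eq_norm_sq_to_K] at h
  have h' : ‖absOp A x‖ ^ 2 = ‖A x‖ ^ 2 := by exact_mod_cast h
  exact (sq_eq_sq₀ (norm_nonneg _) (norm_nonneg _)).mp h'

/-- The absolute value of a bounded operator factors through the operator by a contraction. -/
theorem exists_contraction_comp_eq_absOp (A : H →L[ℂ] H) :
    ∃ V : H →L[ℂ] H, (∀ x, ‖V x‖ ≤ ‖x‖) ∧ ∀ x, V (A x) = absOp A x := by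
  -- `A x ↦ |A| x` is isometric on the range of `A`. It extends to the closure, and by zero to the
  -- orthogonal complement.
  let K : Submodule ℂ H := (LinearMap.range A.toLinearMap).topologicalClosure
  have hmem (x : H) : A x ∈ K := Submodule.le_topologicalClosure _ ⟨x, rfl⟩
  have : CompleteSpace K :=
    (Submodule.isClosed_topologicalClosure _).completeSpace_coe
  let e : H →ₗ[ℂ] K := A.toLinearMap.codRestrict K hmem
  have he : DenseRange e := by
    intro y
    have hy : (y : H) ∈ closure (Set.range A) := y.2
    rw [Metric.mem_closure_iff] at hy ⊢
    intro ε hε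
    obtain ⟨_, ⟨x, rfl⟩, hx⟩ := hy ε hε
    exact ⟨e x, ⟨x, rfl⟩, hx⟩
  have hb (x : H) : ‖(absOp A).toLinearMap x‖ ≤ 1 * ‖e x‖ := by
    rw [one_mul]
    exact (norm_absOp_apply A x).le
  refine ⟨((absOp A).toLinearMap.extendOfNorm e).comp K.orthogonalProjectionOnto,
    fun x => ?_, fun x => ?_⟩
  · calc _ ≤ 1 * ‖K.orthogonalProjectionOnto x‖ := LinearMap.norm_extendOfNorm_apply_le he 1 hb _
      _ ≤ ‖x‖ := by rw [one_mul]; exact K.norm_orthogonalProjectionOnto_apply_le x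
  · have : K.orthogonalProjectionOnto (A x) = e x :=
      Submodule.orthogonalProjectionOnto_mem_subspace_eq_self (e x)
    rw [ContinuousLinearMap.comp_apply, this]
    exact LinearMap.extendOfNorm_eq he ⟨1, hb⟩ x

omit [CompleteSpace H] in
theorem sum_norm_mul_norm_inner_le {v : ι → H} (hv : Orthonormal ℂ v) (t : Finset ι)
    (w : ι → ℂ) (hw : ∑ i ∈ t, ‖w i‖ ^ 2 ≤ 1) (x : H) :
    ∑ i ∈ t, ‖w i‖ * ‖(inner ℂ (v i) x : ℂ)‖ ≤ ‖x‖ := by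
  refine abs_le_of_sq_le_sq' ?_ (norm_nonneg x) |>.2
  calc _ ≤ (∑ i ∈ t, ‖w i‖ ^ 2) * ∑ i ∈ t, ‖(inner ℂ (v i) x : ℂ)‖ ^ 2 :=
        Finset.sum_mul_sq_le_sq_mul_sq _ _ _
    _ ≤ 1 * ‖x‖ ^ 2 :=
        mul_le_mul hw (hv.sum_inner_products_le x) (by positivity) zero_le_one
    _ = ‖x‖ ^ 2 := one_mul _

/-- The trace norm is bounded by the nuclear norm of a row-finite rank-one expansion. -/
theorem traceNorm_le_tsum_of_expansion {κ : Type*} (b : HilbertBasis ι ℂ H) (A : H →L[ℂ] H)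
    (x : κ → H) (w : κ → ι → ℂ) (hw : ∀ j t, ∑ i ∈ t, ‖w j i‖ ^ 2 ≤ 1) (s : ι → Finset κ)
    (hA : ∀ i, A (b i) = ∑ j ∈ s i, w j i • x j) :
    traceNorm b A ≤ ∑' j, ENNReal.ofReal ‖x j‖ := by
  obtain ⟨V, hV, hVA⟩ := exists_contraction_comp_eq_absOp A
  have hterm (i : ι) : ENNReal.ofReal (RCLike.re (inner ℂ (b i) (absOp A (b i)))) ≤
      ∑' j, ENNReal.ofReal (‖w j i‖ * ‖(inner ℂ (b i) (V (x j)) : ℂ)‖) := by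
    calc _ ≤ ENNReal.ofReal (∑ j ∈ s i, ‖w j i‖ * ‖(inner ℂ (b i) (V (x j)) : ℂ)‖) := by
          refine ENNReal.ofReal_le_ofReal ((RCLike.re_le_norm _).trans ?_)
          rw [← hVA, hA, map_sum, inner_sum]
          refine (norm_sum_le _ _).trans (Finset.sum_le_sum fun j _ => ?_)
          rw [map_smul, inner_smul_right, norm_mul]
      _ = ∑ j ∈ s i, ENNReal.ofReal (‖w j i‖ * ‖(inner ℂ (b i) (V (x j)) : ℂ)‖) :=
          ENNReal.ofReal_sum_of_nonneg fun _ _ => by positivity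
      _ ≤ _ := ENNReal.sum_le_tsum _
  refine (ENNReal.tsum_le_tsum hterm).trans ?_
  rw [ENNReal.tsum_comm]
  refine ENNReal.tsum_le_tsum fun j => ?_
  rw [ENNReal.tsum_eq_iSup_sum]
  refine iSup_le fun t => ?_
  rw [← ENNReal.ofReal_sum_of_nonneg fun _ _ => by positivity]
  -- For fixed `j`, Cauchy–Schwarz and Bessel bound the sum over the basis by `‖V (x j)‖`.
  exact ENNReal.ofReal_le_ofReal
    ((sum_norm_mul_norm_inner_le b.orthonormal t (w j) (hw j t) _).trans (hV _))

end Polar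

/-! ### GGT columns from Givens rotations -/

theorem rhoOf_sq {a : ℂ} (ha : ‖a‖ ≤ 1) : rhoOf a ^ 2 = 1 - ‖a‖ ^ 2 :=
  Real.sq_sqrt (by nlinarith [norm_nonneg a])

theorem norm_sq_add_rhoOf_mul_self {a : ℂ} (ha : ‖a‖ ≤ 1) :
    starRingEnd ℂ a * a + (rhoOf a : ℂ) * rhoOf a = 1 := by
  rw [← Complex.normSq_eq_conj_mul_self, Complex.normSq_eq_norm_sq, ← sq]
  exact_mod_cast (by rw [rhoOf_sq ha]; ring : ‖a‖ ^ 2 + rhoOf a ^ 2 = 1)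

theorem inner_stdBasis_left (k : ℕ) (f : SeqSpace) : inner ℂ (stdBasis k) f = f k := by
  rw [← HilbertBasis.repr_apply_apply]
  rfl

theorem stdBasis_coe (n k : ℕ) : (stdBasis n : SeqSpace) k = if k = n then 1 else 0 := by
  rw [stdBasis_apply, lp.single_apply]
  split_ifs with h
  · subst h; exact Pi.single_eq_same k 1
  · exact Pi.single_eq_of_ne h 1

theorem norm_stdBasis (n : ℕ) : ‖stdBasis n‖ = 1 := stdBasis.orthonormal.1 n

/-- The image of `δ_n` under the product of the first `n` Givens rotations with
parameters `α`. -/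
noncomputable def givensVec (α : ℕ → ℂ) : ℕ → SeqSpace
  | 0 => stdBasis 0
  | n + 1 => (rhoOf (α n) : ℂ) • givensVec α n - α n • stdBasis (n + 1)

/-- The `n`-th column of the GGT matrix. -/
noncomputable def ggtCol (α : ℕ → ℂ) (n : ℕ) : SeqSpace :=
  starRingEnd ℂ (α n) • givensVec α n + (rhoOf (α n) : ℂ) • stdBasis (n + 1)

theorem givensVec_coe (α : ℕ → ℂ) (n k : ℕ) : (givensVec α n : SeqSpace) k =
    if k ≤ n then -prevCoeff α k * ∏ m ∈ Finset.Ico k n, (rhoOf (α m) : ℂ) else 0 := by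
  induction n with
  | zero =>
    rw [givensVec, stdBasis_coe]
    by_cases h : k = 0
    · subst h; simp [prevCoeff]
    · simp [h]
  | succ n ih =>
    rw [givensVec, lp.coeFn_sub, Pi.sub_apply, lp.coeFn_smul, Pi.smul_apply, lp.coeFn_smul,
      Pi.smul_apply, ih, stdBasis_coe]
    rcases lt_trichotomy k (n + 1) with h | rfl | h
    · rw [if_pos (by omega), if_neg (by omega), if_pos h.le,
        Finset.prod_Ico_succ_top (by omega)]
      simp only [smul_eq_mul]; ring
    · simp [prevCoeff]
    · rw [if_neg (by omega), if_neg (by omega), if_neg (by omega)]; simp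

theorem ggtCol_coe (α : ℕ → ℂ) (k l : ℕ) : (ggtCol α l : SeqSpace) k = ggt α k l := by
  rw [ggtCol, lp.coeFn_add, Pi.add_apply, lp.coeFn_smul, Pi.smul_apply, lp.coeFn_smul,
      Pi.smul_apply, givensVec_coe, stdBasis_coe, ggt]
  by_cases h : k ≤ l
  · rw [if_pos h, if_pos h, if_neg (by omega)]
    simp only [smul_eq_mul]; ring
  · rw [if_neg h, if_neg h]
    split_ifs <;> simp

theorem inner_givensVec_stdBasis (α : ℕ → ℂ) {n m : ℕ} (h : n < m) :
    (inner ℂ (givensVec α n) (stdBasis m) : ℂ) = 0 := by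
  rw [← inner_conj_symm, inner_stdBasis_left, givensVec_coe, if_neg (by omega), map_zero]

theorem inner_stdBasis_givensVec (α : ℕ → ℂ) {n m : ℕ} (h : n < m) :
    (inner ℂ (stdBasis m) (givensVec α n) : ℂ) = 0 := by
  rw [inner_stdBasis_left, givensVec_coe, if_neg (by omega)]

theorem inner_stdBasis_self (n : ℕ) : (inner ℂ (stdBasis n) (stdBasis n) : ℂ) = 1 := by
  rw [inner_stdBasis_left, stdBasis_coe, if_pos rfl]

theorem inner_stdBasis_of_ne {m n : ℕ} (h : m ≠ n) :
    (inner ℂ (stdBasis m) (stdBasis n) : ℂ) = 0 := by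
  rw [inner_stdBasis_left, stdBasis_coe, if_neg h]

section Columns

variable {α : ℕ → ℂ} (hα : ∀ n, ‖α n‖ ≤ 1)
include hα

theorem inner_givensVec_self (n : ℕ) : (inner ℂ (givensVec α n) (givensVec α n) : ℂ) = 1 := by
  induction n with
  | zero => exact inner_stdBasis_self 0
  | succ n ih =>
    simp only [givensVec, inner_sub_left, inner_sub_right, inner_smul_left, inner_smul_right, ih,
      inner_givensVec_stdBasis α n.lt_succ_self, inner_stdBasis_givensVec α n.lt_succ_self,
      inner_stdBasis_self, Complex.conj_ofReal]
    linear_combination norm_sq_add_rhoOf_mul_self (hα n)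

theorem norm_givensVec (n : ℕ) : ‖givensVec α n‖ = 1 := by
  have h := inner_givensVec_self hα n
  rw [inner_self_eq_norm_sq_to_K] at h
  have h' : ‖givensVec α n‖ ^ 2 = 1 := by
    apply Complex.ofReal_injective
    simpa using h
  exact (pow_eq_one_iff_of_nonneg (norm_nonneg _) two_ne_zero).mp h'

theorem inner_ggtCol_self (n : ℕ) : (inner ℂ (ggtCol α n) (ggtCol α n) : ℂ) = 1 := by
  simp only [ggtCol, inner_add_left, inner_add_right, inner_smul_left, inner_smul_right,
    inner_givensVec_self hα,
    inner_givensVec_stdBasis α n.lt_succ_self, inner_stdBasis_givensVec α n.lt_succ_self,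
    inner_stdBasis_self, Complex.conj_ofReal, Complex.conj_conj]
  linear_combination norm_sq_add_rhoOf_mul_self (hα n)

/-- The two columns of a rotation block are orthogonal, which settles `m = n + 1`. Later vectors
only add basis vectors beyond the support of column `n`. -/
theorem inner_ggtCol_givensVec {n m : ℕ} (h : n < m) :
    (inner ℂ (ggtCol α n) (givensVec α m) : ℂ) = 0 := by
  induction m, h using Nat.le_induction with
  | base =>
    simp only [ggtCol, givensVec, inner_add_left, inner_sub_right, inner_smul_left,
      inner_smul_right, inner_givensVec_self hα,
      inner_givensVec_stdBasis α n.lt_succ_self, inner_stdBasis_givensVec α n.lt_succ_self,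
      inner_stdBasis_self, Complex.conj_ofReal, Complex.conj_conj]
    ring
  | succ m hm ih =>
    rw [givensVec, inner_sub_right, inner_smul_right, inner_smul_right, ih, ggtCol,
      inner_add_left, inner_smul_left, inner_smul_left,
      inner_givensVec_stdBasis α (by omega), inner_stdBasis_of_ne (by omega)]
    ring

theorem inner_ggtCol_of_lt {n m : ℕ} (h : n < m) :
    (inner ℂ (ggtCol α n) (ggtCol α m) : ℂ) = 0 := by
  have h1 : (inner ℂ (ggtCol α n) (stdBasis (m + 1)) : ℂ) = 0 := by
    rw [ggtCol, inner_add_left, inner_smul_left, inner_smul_left,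
      inner_givensVec_stdBasis α (by omega), inner_stdBasis_of_ne (by omega)]
    ring
  rw [ggtCol.eq_def α m, inner_add_right, inner_smul_right,
    inner_smul_right, h1, inner_ggtCol_givensVec hα h]
  ring

theorem orthonormal_ggtCol : Orthonormal ℂ (ggtCol α) := by
  rw [orthonormal_iff_ite]
  intro i j
  rcases lt_trichotomy i j with h | rfl | h
  · rw [if_neg h.ne, inner_ggtCol_of_lt hα h]
  · rw [if_pos rfl, inner_ggtCol_self hα]
  · rw [if_neg h.ne', ← inner_conj_symm, inner_ggtCol_of_lt hα h, map_zero]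

theorem exists_ggt_operator :
    ∃ A : SeqSpace →L[ℂ] SeqSpace, ∀ l, A (stdBasis l) = ggtCol α l := by
  refine ⟨(orthonormal_ggtCol hα).orthogonalFamily.linearIsometry.toContinuousLinearMap,
    fun l => ?_⟩
  rw [stdBasis_apply]
  refine ((orthonormal_ggtCol hα).orthogonalFamily.linearIsometry_apply_single
    (i := l) (1 : ℂ)).trans ?_
  simp

end Columns

/-! ### Rows of the remaining rotations and the telescoped difference -/

/-- The row `δ_n*` of the product of the Givens rotations with parameters `β_n, β_{n+1}, …`. -/
noncomputable def givensRow (β : ℕ → ℂ) (n l : ℕ) : ℂ :=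
  if n ≤ l then starRingEnd ℂ (β l) * ∏ m ∈ Finset.Ico n l, (rhoOf (β m) : ℂ) else 0

/-- Telescopes, since `|β_l|² = 1 - ρ_l²`. -/
theorem sum_norm_givensRow_sq {β : ℕ → ℂ} (hβ : ∀ n, ‖β n‖ ≤ 1) (n N : ℕ) :
    ∑ l ∈ Finset.Ico n (n + N), ‖givensRow β n l‖ ^ 2 =
      1 - ∏ m ∈ Finset.Ico n (n + N), rhoOf (β m) ^ 2 := by
  induction N with
  | zero => simp
  | succ N ih =>
    rw [← add_assoc, Finset.sum_Ico_succ_top (by omega), Finset.prod_Ico_succ_top (by omega), ih,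
      givensRow, if_pos (by omega), norm_mul, RCLike.norm_conj, norm_prod, mul_pow,
      ← Finset.prod_pow, rhoOf_sq (hβ _)]
    simp only [Complex.norm_real, Real.norm_eq_abs, sq_abs]
    ring

theorem sum_norm_givensRow_sq_le_one {β : ℕ → ℂ} (hβ : ∀ n, ‖β n‖ ≤ 1) (n : ℕ) (t : Finset ℕ) :
    ∑ l ∈ t, ‖givensRow β n l‖ ^ 2 ≤ 1 := by
  calc _ = ∑ l ∈ t with n ≤ l, ‖givensRow β n l‖ ^ 2 := by
        rw [Finset.sum_filter]
        refine Finset.sum_congr rfl fun l _ => ?_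
        split_ifs with h
        · rfl
        · simp [givensRow, h]
    _ ≤ ∑ l ∈ Finset.Ico n (n + (t.sup id + 1)), ‖givensRow β n l‖ ^ 2 := by
        refine Finset.sum_le_sum_of_subset_of_nonneg (fun l hl => ?_) fun _ _ _ => by positivity
        rw [Finset.mem_filter] at hl
        have := Finset.le_sup (f := id) hl.1
        simp only [id] at this
        rw [Finset.mem_Ico]
        omega
    _ ≤ 1 := by
        rw [sum_norm_givensRow_sq hβ, sub_le_self_iff]
        exact Finset.prod_nonneg fun _ _ => sq_nonneg _

theorem givensVec_sub (α β : ℕ → ℂ) (l : ℕ) :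
    givensVec α l - givensVec β l = ∑ n ∈ Finset.range l,
      (∏ m ∈ Finset.Ico (n + 1) l, (rhoOf (β m) : ℂ)) •
        (((rhoOf (α n) - rhoOf (β n) : ℝ) : ℂ) • givensVec α n -
          (α n - β n) • stdBasis (n + 1)) := by
  induction l with
  | zero => simp [givensVec]
  | succ l ih =>
    rw [Finset.sum_range_succ, Finset.Ico_self, Finset.prod_empty, one_smul]
    have : ∑ n ∈ Finset.range l, (∏ m ∈ Finset.Ico (n + 1) (l + 1), (rhoOf (β m) : ℂ)) •
        (((rhoOf (α n) - rhoOf (β n) : ℝ) : ℂ) • givensVec α n -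
          (α n - β n) • stdBasis (n + 1)) =
        (rhoOf (β l) : ℂ) • (givensVec α l - givensVec β l) := by
      rw [ih, Finset.smul_sum]
      refine Finset.sum_congr rfl fun n hn => ?_
      rw [Finset.mem_range] at hn
      rw [Finset.prod_Ico_succ_top (by omega), mul_comm, mul_smul]
    -- Uses `ρg - σh = σ(g - h) + (ρ - σ)g`, so the new error sits on the `α` vector, which has norm
    -- 1 when `α` lies in the disk.
    rw [this, givensVec, givensVec]
    push_cast
    module

theorem ggtCol_sub (α β : ℕ → ℂ) (l : ℕ) :
    ggtCol α l - ggtCol β l =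
      (starRingEnd ℂ (α l - β l) • givensVec α l +
        ((rhoOf (α l) - rhoOf (β l) : ℝ) : ℂ) • stdBasis (l + 1)) +
      ∑ n ∈ Finset.range l, givensRow β (n + 1) l •
        (((rhoOf (α n) - rhoOf (β n) : ℝ) : ℂ) • givensVec α n -
          (α n - β n) • stdBasis (n + 1)) := by
  have : ∑ n ∈ Finset.range l, givensRow β (n + 1) l •
        (((rhoOf (α n) - rhoOf (β n) : ℝ) : ℂ) • givensVec α n -
          (α n - β n) • stdBasis (n + 1)) =
      starRingEnd ℂ (β l) • (givensVec α l - givensVec β l) := by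
    rw [givensVec_sub, Finset.smul_sum]
    refine Finset.sum_congr rfl fun n hn => ?_
    rw [Finset.mem_range] at hn
    rw [givensRow, if_pos (by omega), mul_smul]
  rw [this, ggtCol, ggtCol, map_sub]
  push_cast
  module

theorem theorem10p4 (α β : ℕ → ℂ) (hα : ∀ n, ‖α n‖ ≤ 1) (hβ : ∀ n, ‖β n‖ ≤ 1) :
    ∃ A B : SeqSpace →L[ℂ] SeqSpace,
      HasMatrix A (ggt α) ∧ HasMatrix B (ggt β) ∧
      traceNorm stdBasis (A - B) ≤
        2 * ∑' n : ℕ, ENNReal.ofReal (‖α n - β n‖ + |rhoOf (β n) - rhoOf (α n)|) := by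
  obtain ⟨A, hA⟩ := exists_ggt_operator hα
  obtain ⟨B, hB⟩ := exists_ggt_operator hβ
  refine ⟨A, B, fun k l => ?_, fun k l => ?_, ?_⟩
  · rw [hA, inner_stdBasis_left, ggtCol_coe]
  · rw [hB, inner_stdBasis_left, ggtCol_coe]
  let x : ℕ → SeqSpace := fun n => starRingEnd ℂ (α n - β n) • givensVec α n +
    ((rhoOf (α n) - rhoOf (β n) : ℝ) : ℂ) • stdBasis (n + 1)
  let y : ℕ → SeqSpace := fun n => ((rhoOf (α n) - rhoOf (β n) : ℝ) : ℂ) • givensVec α n -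
    (α n - β n) • stdBasis (n + 1)
  have hx (n : ℕ) : ‖x n‖ ≤ ‖α n - β n‖ + |rhoOf (β n) - rhoOf (α n)| := by
    refine (norm_add_le _ _).trans_eq ?_
    rw [norm_smul, norm_smul, norm_givensVec hα, norm_stdBasis, RCLike.norm_conj,
      Complex.norm_real, Real.norm_eq_abs, abs_sub_comm, mul_one, mul_one]
  have hy (n : ℕ) : ‖y n‖ ≤ ‖α n - β n‖ + |rhoOf (β n) - rhoOf (α n)| := by
    refine (norm_sub_le _ _).trans_eq ?_
    rw [norm_smul, norm_smul, norm_givensVec hα, norm_stdBasis,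
      Complex.norm_real, Real.norm_eq_abs, abs_sub_comm, mul_one, mul_one, add_comm]
  -- Later rotations fix `δ_n`, so `x n` pairs with the row `δ_n*`; `y n`, from the block's second
  -- column, pairs with row `n + 1`.
  let w : ℕ ⊕ ℕ → ℕ → ℂ :=
    Sum.elim (fun n l => if l = n then 1 else 0) (fun n => givensRow β (n + 1))
  have hw (j : ℕ ⊕ ℕ) (t : Finset ℕ) : ∑ i ∈ t, ‖w j i‖ ^ 2 ≤ 1 := by
    rcases j with n | n
    · calc ∑ i ∈ t, ‖w (Sum.inl n) i‖ ^ 2 = ∑ i ∈ t, if i = n then (1 : ℝ) else 0 := by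
            refine Finset.sum_congr rfl fun i _ => ?_
            simp only [w, Sum.elim_inl]
            split_ifs <;> simp
        _ ≤ 1 := by
            rw [Finset.sum_ite_eq']
            split_ifs <;> norm_num
    · exact sum_norm_givensRow_sq_le_one hβ (n + 1) t
  have hAB (l : ℕ) : (A - B) (stdBasis l) =
      ∑ j ∈ Finset.disjSum {l} (Finset.range l), w j l • Sum.elim x y j := by
    rw [sub_apply, hA, hB, ggtCol_sub, Finset.sum_disjSum,
      Finset.sum_singleton]
    simp only [w, Sum.elim_inl, Sum.elim_inr, if_true, one_smul, x, y]
  refine (traceNorm_le_tsum_of_expansion stdBasis (A - B) (Sum.elim x y) w hw _ hAB).trans ?_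
  rw [Summable.tsum_sum ENNReal.summable ENNReal.summable, two_mul]
  exact add_le_add (ENNReal.tsum_le_tsum fun n => ENNReal.ofReal_le_ofReal (hx n))
    (ENNReal.tsum_le_tsum fun n => ENNReal.ofReal_le_ofReal (hy n))
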